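/- A tournament $T$ consists of a vertex set $V(T)$ and a set $A(T)$ of ordered pairs of distinct vertices (arcs) such that for any two distinct vertices $x,y$ exactly one of $(x,y),(y,x)$ is an arc. A tournament $S$ embeds in $T$ if $S$ is isomorphic to the tournament induced by $T$ on some subset of $V(T)$; $T-x$ is the tournament induced on $V(T)\setminus\{x\}$. A tournament is acyclic if the $3$-cycle (with vertices $0,1,2$ and arcs $(0,1),(1,2),(2,0)$) does not embed in it. For $X\subseteq V(T)$, $\mathrm{Inv}(T,X)$ is the tournament obtained from $T$ by reversing all arcs with both ends in $X$, and $\mathrm{Inv}(T,(X_0,\dots,X_{m-1}))$ is obtained by successively inverting $X_0,\dots,X_{m-1}$. The inversion index $i(T)$ is the least $m\in\mathbb N$ such that $\mathrm{Inv}(T,(X_0,\dots,X_{m-1}))$ is acyclic for some subsets $X_0,\dots,X_{m-1}$ of $V(T)$ (and $\infty$ if there is no such $m$). Let $\mathcal I_1^{<\omega}$ be the class of finite tournaments $T$ with $i(T)\le 1$. A bound of a class $\mathcal C$ of finite tournaments is a finite tournament $T\notin\mathcal C$ such that $T-x\in\mathcal C$ for every $x\in V(T)$. For a class $B$ of finite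 tournaments, $\mathrm{Forb}(B)$ is the class of finite tournaments in which no member of $B$ embeds. An interval of $T$ is a set $X\subseteq V(T)$ such that for each $y\in V(T)\setminus X$, either $(x,y)\in A(T)$ for all $x\in X$, or $(y,x)\in A(T)$ for all $x\in X$. $T$ is indecomposable if its only intervals are $\emptyset$, $V(T)$ and the singletons, and decomposable otherwise. A nonempty finite indecomposable tournament $T$ is critical if $T-x$ is decomposable for every vertex $x$. Let $\underline n$ be the tournament on $\{0,\dots,n-1\}$ with arcs $(i,j)$ for $i<j$, let $P_7$ be the tournament on $\mathbb Z/7\mathbb Z$ with arcs $(i,j)$ for $j-i\in\{1,2,4\}$, and put $$B_6:=P_7-6,\quad C_3.\underline 2:=\mathrm{Inv}(\underline 6,(\{0,2\},\{3,5\})),\quad D_5:=\mathrm{Inv}(\underline 5,(\{1,3\},\{0,4\})),$$ $$T_5:=\mathrm{Inv}(\underline 5,(\{0,2,4\},\{1,3\})),\quad V_5:=\mathrm{Inv}(\underline 5,(\{0,2,4\},\{0,2\})).$$ **Theorem.** A tournament is a bound of $\mathcal I_1^{<\omega}$ if and only if it is isomorphic to one of $B_6$, $C_3.\underline 2$, $D_5$,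 $T_5$, $V_5$. These five tournaments are pairwise non-isomorphic, and $T_5$ and $V_5$ are critical. Moreover $\mathcal I_1^{<\omega}=\mathrm{Forb}(\{B_6,C_3.\underline 2,D_5,T_5,V_5\})$. -/

import Mathlib

universe u v

/-- A tournament on the vertex set `V`: a loopless digraph in which any two distinct vertices
are joined by exactly one arc. `T.Adj x y` means that `(x, y)` is an arc of `T`. -/
@[ext]
structure Tournament (V : Type u) extends Digraph V where
  irrefl : ∀ x, ¬ Adj x x
  exactly_one : ∀ x y, x ≠ y → (Adj x y ↔ ¬ Adj y x)

namespace Tournament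

variable {V : Type u} {W : Type v}

/-- Isomorphism of tournaments. -/
def Isomorphic (S : Tournament W) (T : Tournament V) : Prop :=
  Nonempty (S.Adj ≃r T.Adj)

/-- `S` embeds in `T`: `S` is isomorphic to the tournament induced by `T` on some
set of vertices. -/
def Embeds (S : Tournament W) (T : Tournament V) : Prop :=
  Nonempty (S.Adj ↪r T.Adj)

/-- The tournament `T - x`. -/
def delete (T : Tournament V) (x : V) : Tournament {y : V // y ≠ x} where
  Adj a b := T.Adj a b
  irrefl a := T.irrefl a
  exactly_one a b h := T.exactly_one a b (fun hab => h (Subtype.ext hab))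

/-- The tournament `Inv(T, X)`, obtained by reversing all arcs of `T` with both ends in `X`. -/
def inv (T : Tournament V) (X : Set V) : Tournament V where
  Adj x y := ((x ∈ X ∧ y ∈ X) ∧ T.Adj y x) ∨ (¬ (x ∈ X ∧ y ∈ X) ∧ T.Adj x y)
  irrefl x := by
    have := T.irrefl x
    tauto
  exactly_one x y h := by
    have := T.exactly_one x y h
    tauto

/-- `Inv(T, (X₀, …, Xₘ₋₁))`: the inversions with respect to `X₀`, …, `Xₘ₋₁` are performed
successively, in this order. -/
def invSeq (T : Tournament V) (Xs : List (Set V)) : Tournament V :=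
  Xs.foldl inv T

/-- The 3-cycle, with arcs `(0,1)`, `(1,2)`, `(2,0)`. -/
def C3 : Tournament (Fin 3) where
  Adj x y := (x, y) ∈ ({(0, 1), (1, 2), (2, 0)} : Finset (Fin 3 × Fin 3))
  irrefl := by decide
  exactly_one := by decide

/-- A tournament is acyclic if the 3-cycle does not embed in it. -/
def IsAcyclic (T : Tournament V) : Prop := ¬ C3.Embeds T

/-- The inversion index: the least length of a finite sequence of vertex sets whose successive
inversions turn `T` into an acyclic tournament, and `⊤` if there is no such sequence. -/
noncomputable def inversionIndex (T : Tournament V) : ℕ∞ :=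
  ⨅ (Xs : List (Set V)) (_ : (T.invSeq Xs).IsAcyclic), (Xs.length : ℕ∞)

/-- Intervals (autonomous sets) of a tournament. -/
def IsInterval (T : Tournament V) (X : Set V) : Prop :=
  ∀ y, y ∉ X → ∀ x ∈ X, ∀ x' ∈ X, (T.Adj x y ↔ T.Adj x' y) ∧ (T.Adj y x ↔ T.Adj y x')

/-- A tournament is indecomposable if its only intervals are the trivial ones: `∅`, the whole
vertex set and the singletons. -/
def IsIndecomposable (T : Tournament V) : Prop :=
  ∀ X : Set V, T.IsInterval X → X = ∅ ∨ X = Set.univ ∨ ∃ x, X = {x}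

/-- A tournament is critical if it is nonempty, finite and indecomposable, and `T - x` is
decomposable for every vertex `x`. -/
def IsCritical (T : Tournament V) : Prop :=
  Nonempty V ∧ Finite V ∧ T.IsIndecomposable ∧ ∀ x, ¬ (T.delete x).IsIndecomposable

/-- The acyclic tournament `n̲` on `{0, …, n-1}`, with arcs `(i, j)` for `i < j`. -/
def chain (n : ℕ) : Tournament (Fin n) where
  Adj i j := i < j
  irrefl i := lt_irrefl i
  exactly_one i j h := by
    constructor
    · exact fun hij => hij.not_gt
    · exact fun hji => lt_of_le_of_ne (not_lt.mp hji) h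

/-- The Paley tournament on `ℤ/7ℤ`. -/
def P7 : Tournament (ZMod 7) where
  Adj i j := j - i ∈ ({1, 2, 4} : Finset (ZMod 7))
  irrefl := by decide
  exactly_one := by decide

/-- `B₆ = P₇ - 6`. -/
def B6 : Tournament {y : ZMod 7 // y ≠ 6} := P7.delete 6

/-- `C₃.2̲`. -/
def C3dot2 : Tournament (Fin 6) := (chain 6).invSeq [{0, 2}, {3, 5}]

/-- `D₅`. -/
def D5 : Tournament (Fin 5) := (chain 5).invSeq [{1, 3}, {0, 4}]

/-- `T₅`. -/
def T5 : Tournament (Fin 5) := (chain 5).invSeq [{0, 2, 4}, {1, 3}]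

/-- `V₅`. -/
def V5 : Tournament (Fin 5) := (chain 5).invSeq [{0, 2, 4}, {0, 2}]

end Tournament

/-- A tournament together with its vertex set. -/
abbrev AnyTournament : Type (u + 1) := Σ V : Type u, Tournament V

/-- The class `I_m^{<ω}` of finite tournaments of inversion index at most `m`. -/
def finiteInversionClass (m : ℕ) : Set AnyTournament.{u} :=
  {T | Finite T.1 ∧ T.2.inversionIndex ≤ m}

/-- The bounds of a class `C` of finite tournaments: the finite tournaments `T` not in `C` such
that `T - x` is in `C` for every vertex `x`. -/
def bounds (C : Set AnyTournament.{u}) : Set AnyTournament.{u} :=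
  {T | Finite T.1 ∧ T ∉ C ∧ ∀ x : T.1, (⟨_, T.2.delete x⟩ : AnyTournament.{u}) ∈ C}

/-- `Forb(B)`: the class of the finite tournaments in which no member of `B` embeds. -/
def Forb (B : Set AnyTournament.{v}) : Set AnyTournament.{u} :=
  {T | Finite T.1 ∧ ∀ S ∈ B, ¬ S.2.Embeds T.2}

/-- The set `{B₆, C₃.2̲, D₅, T₅, V₅}`. -/
def fiveTournaments : Set AnyTournament.{0} :=
  {⟨_, Tournament.B6⟩, ⟨_, Tournament.C3dot2⟩, ⟨_, Tournament.D5⟩, ⟨_, Tournament.T5⟩,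
    ⟨_, Tournament.V5⟩}

/-!
Inverting `X` turns `T` into an acyclic tournament only if `X` contains exactly two vertices of each
3-cycle of `T`. Fix a 3-cycle `a → b → c → a`. If `X` contains `a` and `b` but not `c`, then for every
vertex `v` the requirement that `{a, b, c, v}` become acyclic decides whether `v ∈ X`. So there are
only three candidates for `X`, one for each vertex of the 3-cycle (`candidate`), and `T` has
inversion index at most `1` if and only if `T` is acyclic or one of them works.

A candidate fails because a 3-cycle is left after its inversion. Unless `T` contains one of the five
tournaments, there is then such a 3-cycle that meets `{a, b, c}` (`exists_refutes`); its other two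
vertices are said to refute the candidate. A verification on five vertices shows that a pair refutes
none, two, or all three of the candidates, and in the last case `D₅`, `T₅` or `V₅` embeds. Hence, if
all three candidates fail, two pairs suffice to refute them all. These pairs span, together with
`a`, `b`, `c`, at most seven vertices, and a verification on six and on seven vertices finds a copy of
one of the five tournaments (`refuted_sup_ne_top`). The verifications are decided by the kernel; a
copy is searched for one vertex at a time (`Realizes`).

Conversely none of the five tournaments `S` has inversion index at most `1`, while all tournaments
`S - x` have. As the class contains every tournament that embeds in one of its members, a bound is
not larger than the copy of one of the five tournaments that it contains.
-/

namespace Tournament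

variable {α : Type u} {β : Type v} {V : Type u} {W : Type v}

/-! ### Searching for copies of small tournaments -/

/-- `Matches A x r ch`: the vertex `x` is joined to the vertices of the list `ch` as prescribed by
the list `r`, where `true` stands for an arc towards `x` and `false` for an arc from `x`. -/
def Matches (A : α → α → Bool) (x : α) : List Bool → List α → Bool
  | d :: r, y :: ch => (bif d then A y x else A x y) && Matches A x r ch
  | _, _ => true

/-- A tournament on `0, …, n - 1` is coded by its columns: the `j`-th list records, for `i < j`,
whether `(i, j)` is an arc. `Realizes A cols ch` says that the list `ch` of vertices can be
extended by one vertex for each list of `cols`, the arcs to the earlier vertices being as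
prescribed; for `ch = []` this is a copy of the coded tournament in `A`. -/
def Realizes (A : α → α → Bool) : List (List Bool) → List α → Prop
  | [], _ => True
  | r :: rs, ch => ∃ x, Matches A x r ch = true ∧ Realizes A rs (ch ++ [x])

instance Realizes.decidable {n : ℕ} (A : Fin n → Fin n → Bool) :
    ∀ cols ch, Decidable (Realizes A cols ch)
  | [], _ => inferInstanceAs (Decidable True)
  | r :: rs, ch =>
    have : DecidablePred fun x => Matches A x r ch = true ∧ Realizes A rs (ch ++ [x]) := fun x =>
      have := Realizes.decidable A rs (ch ++ [x])
      inferInstance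
    inferInstanceAs (Decidable (∃ x, Matches A x r ch = true ∧ Realizes A rs (ch ++ [x])))

theorem Matches.map {A : α → α → Bool} {B : β → β → Bool} (f : α → β)
    (h : ∀ x y, A x y = B (f x) (f y)) (x : α) :
    ∀ (r : List Bool) (ch : List α), Matches B (f x) r (ch.map f) = Matches A x r ch
  | [], _ => by simp [Matches]
  | _ :: _, [] => by simp [Matches]
  | d :: r, y :: ch => by simp [Matches, h, Matches.map f h x r ch]

theorem Realizes.map {A : α → α → Bool} {B : β → β → Bool} (f : α → β)
    (h : ∀ x y, A x y = B (f x) (f y)) :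
    ∀ {cols : List (List Bool)} {ch : List α}, Realizes A cols ch → Realizes B cols (ch.map f)
  | [], _, _ => trivial
  | r :: rs, ch, ⟨x, hx, hrs⟩ =>
    ⟨f x, by rw [Matches.map f h, hx], by simpa using Realizes.map f h hrs⟩

/-- The columns of `B₆`. -/
def colsB6 : List (List Bool) :=
  [[], [true], [true, true], [false, true, true], [true, false, true, true],
    [false, true, false, true, true]]

/-- The columns of `C₃.2̲`. -/
def colsC3dot2 : List (List Bool) :=
  [[], [true], [false, true], [true, true, true], [true, true, true, true],
    [true, true, true, false, true]]

/-- The columns of `D₅`. -/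
def colsD5 : List (List Bool) :=
  [[], [true], [true, true], [true, false, true], [false, true, true, true]]

/-- The columns of `T₅`. -/
def colsT5 : List (List Bool) :=
  [[], [true], [false, true], [true, false, true], [false, true, false, true]]

/-- The columns of `V₅`. -/
def colsV5 : List (List Bool) :=
  [[], [true], [true, true], [true, true, true], [false, true, false, true]]

/-- One of the five tournaments has a copy in `A`. -/
def HasCopy (A : α → α → Bool) : Prop :=
  Realizes A colsD5 [] ∨ Realizes A colsT5 [] ∨ Realizes A colsV5 [] ∨ Realizes A colsB6 [] ∨
    Realizes A colsC3dot2 []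

instance {n : ℕ} (A : Fin n → Fin n → Bool) : Decidable (HasCopy A) :=
  inferInstanceAs (Decidable (_ ∨ _))

theorem HasCopy.map {A : α → α → Bool} {B : β → β → Bool} (f : α → β)
    (h : ∀ x y, A x y = B (f x) (f y)) : HasCopy A → HasCopy B :=
  Or.imp (Realizes.map f h) <| Or.imp (Realizes.map f h) <| Or.imp (Realizes.map f h) <|
    Or.imp (Realizes.map f h) (Realizes.map f h)

/-! ### The candidate sets of a 3-cycle -/

/-- Membership of `v` in the candidate set of the 3-cycle `a → b → c → a` that leaves out `c`: the
only set containing `a` and `b` but not `c` whose inversion makes `{a, b, c, v}` acyclic for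
every `v`. The formula is also correct for `v` among `a`, `b`, `c`, as `A v v = false`. -/
def candidate (A : α → α → Bool) (a b c v : α) : Bool :=
  bif A a v then !A b v || !A c v else !A b v && A c v

/-- The arcs after the inversion of the set with indicator `x`. -/
def invArc (A : α → α → Bool) (x : α → Bool) (p q : α) : Bool :=
  bif x p && x q then A q p else A p q

/-- After the inversion of `x`, there is a 3-cycle `p → q → r → p`. -/
def invCycle (A : α → α → Bool) (x : α → Bool) (p q r : α) : Bool :=
  invArc A x p q && invArc A x q r && invArc A x r p

/-- The pair `u, v` refutes the candidate set that leaves out `c`: after its inversion, `u`, `v` and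
one of `a`, `b`, `c` form a 3-cycle. -/
def refutes (A : α → α → Bool) (a b c u v : α) : Bool :=
  [a, b, c].any fun p =>
    invCycle A (candidate A a b c) p u v || invCycle A (candidate A a b c) p v u

/-- Triples of truth values, indexed by the vertices of a 3-cycle; they form a Boolean algebra. -/
abbrev Triple := Bool × Bool × Bool

/-- Which of the candidate sets that leave out `a`, `b` and `c` are refuted by the pair `u, v`. -/
def refuted (A : α → α → Bool) (a b c u v : α) : Triple :=
  (refutes A b c a u v, refutes A c a b u v, refutes A a b c u v)

/-- At least two of the three values are `true`. -/
def Triple.Majority (k : Triple) : Prop :=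
  (k.1 || k.2.1) = true ∧ (k.1 || k.2.2) = true ∧ (k.2.1 || k.2.2) = true

instance (k : Triple) : Decidable k.Majority := inferInstanceAs (Decidable (_ ∧ _))

/-! ### Finite verifications -/

/-- The tournament on `0, …, n - 1` with the given columns. -/
def ofColumns (cols : List (List Bool)) (n : ℕ) (i j : Fin n) : Bool :=
  let d := fun i j : ℕ => (cols.getD j []).getD i false
  bif Nat.blt i j then d i j else bif Nat.blt j i then !(d j i) else false

/-- The three values as a list. -/
def Triple.toList (x : Triple) : List Bool := [x.1, x.2.1, x.2.2]

/-- The tournament on a 3-cycle `0, 1, 2` and two further vertices: `x` and `y` record the arcs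
from the 3-cycle to these, and `dxy` whether the arc between them goes from `3` to `4`. -/
def model5 (x y : Triple) (dxy : Bool) : Fin 5 → Fin 5 → Bool :=
  ofColumns [[], [true], [false, true], x.toList, y.toList ++ [dxy]] 5

/-- The analogue of `model5` with three further vertices. -/
def model6 (x y z : Triple) (dxy dxz dyz : Bool) : Fin 6 → Fin 6 → Bool :=
  ofColumns [[], [true], [false, true], x.toList, y.toList ++ [dxy], z.toList ++ [dxz, dyz]] 6

/-- The analogue of `model5` with four further vertices. -/
def model7 (x y z w : Triple) (dxy dzw dxz dyz dxw dyw : Bool) : Fin 7 → Fin 7 → Bool :=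
  ofColumns [[], [true], [false, true], x.toList, y.toList ++ [dxy], z.toList ++ [dxz, dyz],
    w.toList ++ [dxw, dyw, dzw]] 7

/-- The candidate sets refuted by the two further vertices of `model5`. -/
def pairRefuted (x y : Triple) (dxy : Bool) : Triple :=
  refuted (model5 x y dxy) 0 1 2 3 4

/-- A pair that refutes a candidate set refutes at least two. -/
theorem majority_pairRefuted : ∀ (x y : Triple) (d : Bool),
    pairRefuted x y d ≠ ⊥ → (pairRefuted x y d).Majority := by
  decide +kernel

/-- A pair that refutes all three candidate sets yields a copy of `D₅`, `T₅` or `V₅`. -/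
theorem hasCopy_model5 : ∀ (x y : Triple) (d : Bool),
    pairRefuted x y d = ⊤ → HasCopy (model5 x y d) := by
  decide +kernel

/-- If no pair refutes a candidate set, but three vertices outside the 3-cycle form a 3-cycle after
its inversion, then there is a copy. -/
theorem hasCopy_model6_of_invCycle : ∀ (x y : Triple) (dxy : Bool),
    (pairRefuted x y dxy).2.2 = false →
    ∀ (z : Triple) (dxz : Bool), (pairRefuted x z dxz).2.2 = false →
    ∀ dyz, (pairRefuted y z dyz).2.2 = false →
    invCycle (model6 x y z dxy dxz dyz) (candidate (model6 x y z dxy dxz dyz) 0 1 2) 3 4 5 = true →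
    HasCopy (model6 x y z dxy dxz dyz) := by
  decide +kernel

/-- If two pairs with a common vertex refute all three candidate sets together, there is a copy. -/
theorem hasCopy_model6_of_sup : ∀ (x y : Triple) (dxy : Bool),
    pairRefuted x y dxy ≠ ⊥ → pairRefuted x y dxy ≠ ⊤ →
    ∀ (z : Triple) (dxz : Bool), pairRefuted x z dxz ≠ ⊤ →
    pairRefuted x y dxy ⊔ pairRefuted x z dxz = ⊤ →
    ∀ dyz, HasCopy (model6 x y z dxy dxz dyz) := by
  decide +kernel

set_option synthInstance.maxHeartbeats 400000 in
set_option synthInstance.maxSize 1000 in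
/-- If two disjoint pairs refute all three candidate sets together, and no pair meeting both refutes
any, there is a copy of `V₅`. -/
theorem realizes_colsV5_model7 : ∀ (x y : Triple) (dxy : Bool),
    pairRefuted x y dxy ≠ ⊥ → pairRefuted x y dxy ≠ ⊤ →
    ∀ (z w : Triple) (dzw : Bool), pairRefuted z w dzw ≠ ⊤ →
    pairRefuted x y dxy ⊔ pairRefuted z w dzw = ⊤ →
    ∀ dxz, pairRefuted x z dxz = ⊥ → ∀ dyz, pairRefuted y z dyz = ⊥ →
    ∀ dxw, pairRefuted x w dxw = ⊥ → ∀ dyw, pairRefuted y w dyw = ⊥ →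
    Realizes (model7 x y z w dxy dzw dxz dyz dxw dyw) colsV5 [] := by
  decide +kernel

/-! ### Cycles and inversions -/

theorem ne_of_adj {T : Tournament V} {x y : V} (h : T.Adj x y) : x ≠ y := by
  rintro rfl
  exact T.irrefl x h

theorem adj_or_adj (T : Tournament V) {x y : V} (h : x ≠ y) : T.Adj x y ∨ T.Adj y x := by
  have := T.exactly_one x y h
  tauto

theorem not_adj_of_adj {T : Tournament V} {x y : V} (h : T.Adj x y) : ¬ T.Adj y x :=
  (T.exactly_one x y (ne_of_adj h)).1 h

/-- A map between tournaments that preserves arcs is an embedding. -/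
theorem embeds_of_hom {S : Tournament W} {T : Tournament V} (f : W → V)
    (h : ∀ x y, S.Adj x y → T.Adj (f x) (f y)) : S.Embeds T := by
  refine ⟨⟨⟨f, fun x y hxy => ?_⟩, fun {x y} => ⟨fun hf => ?_, h x y⟩⟩⟩
  · by_contra hne
    rcases S.adj_or_adj hne with h' | h'
    · exact ne_of_adj (h _ _ h') hxy
    · exact ne_of_adj (h _ _ h') hxy.symm
  · have hne : x ≠ y := by
      rintro rfl
      exact T.irrefl _ hf
    refine (S.adj_or_adj hne).resolve_right fun h' => not_adj_of_adj (h _ _ h') hf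

instance : DecidableRel C3.Adj := fun x y =>
  inferInstanceAs (Decidable ((x, y) ∈ ({(0, 1), (1, 2), (2, 0)} : Finset (Fin 3 × Fin 3))))

theorem isAcyclic_iff (T : Tournament V) :
    T.IsAcyclic ↔ ∀ p q r, T.Adj p q → T.Adj q r → ¬ T.Adj r p := by
  constructor
  · intro h p q r hpq hqr hrp
    refine h (embeds_of_hom ![p, q, r] fun i j hij => ?_)
    fin_cases i <;> fin_cases j <;> first | exact absurd hij (by decide) | assumption
  · rintro h ⟨f⟩
    exact h (f 0) (f 1) (f 2) (f.map_rel_iff.2 (by decide)) (f.map_rel_iff.2 (by decide))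
      (f.map_rel_iff.2 (by decide))

/-- A tournament that an inversion of one set makes acyclic. -/
def Invertible (T : Tournament V) : Prop := ∃ X : Set V, (T.inv X).IsAcyclic

theorem inv_empty (T : Tournament V) : T.inv ∅ = T := by
  ext x y
  simp [inv]

theorem inversionIndex_le_one_iff (T : Tournament V) : T.inversionIndex ≤ 1 ↔ T.Invertible := by
  constructor
  · intro h
    by_contra hT
    have h2 : (2 : ℕ∞) ≤ T.inversionIndex := by
      refine le_iInf₂ fun Xs hXs => ?_
      match Xs, hXs with
      | [], hXs => exact absurd ⟨∅, by rwa [inv_empty]⟩ hT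
      | [X], hXs => exact absurd ⟨X, hXs⟩ hT
      | X :: Y :: Zs, _ => exact_mod_cast (by simp : 2 ≤ (X :: Y :: Zs).length)
    exact absurd (h2.trans h) (by norm_num)
  · rintro ⟨X, hX⟩
    exact iInf₂_le_of_le [X] hX (by simp)

theorem Invertible.of_embeds {S : Tournament W} {T : Tournament V} (h : S.Embeds T) :
    T.Invertible → S.Invertible := by
  obtain ⟨f⟩ := h
  rintro ⟨X, hX⟩
  refine ⟨f ⁻¹' X, (isAcyclic_iff _).2 fun p q r => ?_⟩
  have := (isAcyclic_iff _).1 hX (f p) (f q) (f r)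
  simpa only [inv, f.map_rel_iff, Set.mem_preimage] using this

/-- The adjacency of a tournament as a truth value. -/
def arc (T : Tournament V) [DecidableRel T.Adj] (x y : V) : Bool := decide (T.Adj x y)

section arc

variable (T : Tournament V) [DecidableRel T.Adj]

theorem arc_self (x : V) : T.arc x x = false := by
  simp [arc, T.irrefl]

theorem arc_swap {x y : V} (h : x ≠ y) : T.arc y x = !T.arc x y := by
  have := T.exactly_one x y h
  by_cases h' : T.Adj y x <;> simp_all [arc]

theorem ne_of_arc {x y : V} (h : T.arc x y = true) : x ≠ y := by
  rintro rfl
  simp [arc_self] at h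

theorem invCycle_eq_true_iff (x : V → Bool) (p q r : V) :
    invCycle T.arc x p q r = true ↔
      (T.inv {v | x v}).Adj p q ∧ (T.inv {v | x v}).Adj q r ∧ (T.inv {v | x v}).Adj r p := by
  simp only [invCycle, invArc, inv, arc, Set.mem_ofPred_eq]
  cases x p <;> cases x q <;> cases x r <;> simp [and_assoc]

theorem invCycle_rotate {α : Type*} (A : α → α → Bool) (x : α → Bool) (p q r : α) :
    invCycle A x q r p = invCycle A x p q r := by
  simp only [invCycle]
  cases invArc A x p q <;> cases invArc A x q r <;> cases invArc A x r p <;> rfl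

theorem invArc_self (x : V → Bool) (p : V) : invArc T.arc x p p = false := by
  cases h : x p <;> simp [invArc, arc_self, h]

theorem refutes_comm {α : Type*} (A : α → α → Bool) (a b c u v : α) :
    refutes A a b c u v = refutes A a b c v u := by
  simp [refutes, Bool.or_comm]

theorem refuted_comm {α : Type*} (A : α → α → Bool) (a b c u v : α) :
    refuted A a b c u v = refuted A a b c v u := by
  simp only [refuted, refutes_comm A _ _ _ u v]

variable {T}
variable {a b c : V}

/-- The first vertex of a refuting pair lies outside the 3-cycle and differs from the second: in a
set of four vertices containing the 3-cycle, the candidate set leaves no 3-cycle. -/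
theorem ne_of_refutes (hab : T.arc a b = true) (hbc : T.arc b c = true)
    (hca : T.arc c a = true) {u v : V} (h : refutes T.arc a b c u v = true) :
    u ≠ a ∧ u ≠ b ∧ u ≠ c ∧ u ≠ v := by
  have hba := T.arc_swap (T.ne_of_arc hab)
  have hcb := T.arc_swap (T.ne_of_arc hbc)
  have hac := T.arc_swap (T.ne_of_arc hca)
  rw [hab] at hba; rw [hbc] at hcb; rw [hca] at hac
  have ha := T.arc_self a
  have hb := T.arc_self b
  have hc := T.arc_self c
  have key : ∀ u, u = a ∨ u = b ∨ u = c → refutes T.arc a b c u v = false := by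
    intro u hu
    by_cases hva : v = a
    · rcases hu with hu | hu | hu <;> rw [hu, hva] <;>
        simp [refutes, invCycle, invArc, candidate, *]
    by_cases hvb : v = b
    · rcases hu with hu | hu | hu <;> rw [hu, hvb] <;>
        simp [refutes, invCycle, invArc, candidate, *]
    by_cases hvc : v = c
    · rcases hu with hu | hu | hu <;> rw [hu, hvc] <;>
        simp [refutes, invCycle, invArc, candidate, *]
    have h1 := T.arc_swap (Ne.symm hva)
    have h2 := T.arc_swap (Ne.symm hvb)
    have h3 := T.arc_swap (Ne.symm hvc)
    rcases hu with hu | hu | hu <;> rw [hu] <;> cases h4 : T.arc a v <;> cases h5 : T.arc b v <;>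
      cases h6 : T.arc c v <;> simp [refutes, invCycle, invArc, candidate, *]
  refine ⟨?_, ?_, ?_, ?_⟩
  · rintro rfl; simp [key] at h
  · rintro rfl; simp [key] at h
  · rintro rfl; simp [key] at h
  · rintro rfl; simp [refutes, invCycle, T.invArc_self] at h

end arc

/-! ### A tournament without copies has an unrefuted candidate -/

section candidates

variable (T : Tournament V) [DecidableRel T.Adj]

theorem ofColumns_eq {n : ℕ} {cols : List (List Bool)} {f : Fin n → V}
    (hf : Function.Injective f)
    (h : ∀ i j : Fin n, i < j → (cols.getD j []).getD i false = T.arc (f i) (f j)) (i j : Fin n) :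
    ofColumns cols n i j = T.arc (f i) (f j) := by
  rcases lt_trichotomy i j with hij | rfl | hij
  · have h1 : Nat.blt i j = true := by simpa [Nat.blt_eq] using hij
    simp only [ofColumns, h1, cond_true, h i j hij]
  · have h1 : Nat.blt i i = false := by simp [← Bool.not_eq_true, Nat.blt_eq]
    simp [ofColumns, h1, T.arc_self]
  · have h1 : Nat.blt j i = true := by simpa [Nat.blt_eq] using hij
    have h2 : Nat.blt i j = false := by
      simpa [← Bool.not_eq_true, Nat.blt_eq] using hij.le
    simp only [ofColumns, h1, h2, cond_true, cond_false, h j i hij]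
    exact (T.arc_swap (hf.ne hij.ne)).symm

/-- Which of `a`, `b`, `c` have an arc to `v`. -/
def profile (a b c v : V) : Triple := (T.arc a v, T.arc b v, T.arc c v)

variable {T}
variable {a b c : V}

theorem model5_eq (hab : T.arc a b = true) (hbc : T.arc b c = true) (hca : T.arc c a = true)
    {x y : V} (hn : [a, b, c, x, y].Nodup) (i j : Fin 5) :
    model5 (T.profile a b c x) (T.profile a b c y) (T.arc x y) i j =
      T.arc ([a, b, c, x, y].get i) ([a, b, c, x, y].get j) := by
  have hac : T.arc a c = false := by rw [T.arc_swap (T.ne_of_arc hca), hca]; rfl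
  refine T.ofColumns_eq (List.nodup_iff_injective_get.1 hn) (fun i j hij => ?_) i j
  fin_cases i <;> fin_cases j <;>
    first | (exfalso; simp at hij; done) | simp [Triple.toList, profile, *]

theorem model6_eq (hab : T.arc a b = true) (hbc : T.arc b c = true) (hca : T.arc c a = true)
    {x y z : V} (hn : [a, b, c, x, y, z].Nodup) (i j : Fin 6) :
    model6 (T.profile a b c x) (T.profile a b c y) (T.profile a b c z)
        (T.arc x y) (T.arc x z) (T.arc y z) i j =
      T.arc ([a, b, c, x, y, z].get i) ([a, b, c, x, y, z].get j) := by
  have hac : T.arc a c = false := by rw [T.arc_swap (T.ne_of_arc hca), hca]; rfl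
  refine T.ofColumns_eq (List.nodup_iff_injective_get.1 hn) (fun i j hij => ?_) i j
  fin_cases i <;> fin_cases j <;>
    first | (exfalso; simp at hij; done) | simp [Triple.toList, profile, *]

theorem model7_eq (hab : T.arc a b = true) (hbc : T.arc b c = true) (hca : T.arc c a = true)
    {x y z w : V} (hn : [a, b, c, x, y, z, w].Nodup) (i j : Fin 7) :
    model7 (T.profile a b c x) (T.profile a b c y) (T.profile a b c z) (T.profile a b c w)
        (T.arc x y) (T.arc z w) (T.arc x z) (T.arc y z) (T.arc x w) (T.arc y w) i j =
      T.arc ([a, b, c, x, y, z, w].get i) ([a, b, c, x, y, z, w].get j) := by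
  have hac : T.arc a c = false := by rw [T.arc_swap (T.ne_of_arc hca), hca]; rfl
  refine T.ofColumns_eq (List.nodup_iff_injective_get.1 hn) (fun i j hij => ?_) i j
  fin_cases i <;> fin_cases j <;>
    first | (exfalso; simp at hij; done) | simp [Triple.toList, profile, *]

/-- A refutation only depends on the subtournament on the 3-cycle and the pair. -/
theorem pairRefuted_eq (hab : T.arc a b = true) (hbc : T.arc b c = true) (hca : T.arc c a = true)
    {x y : V} (hn : [a, b, c, x, y].Nodup) :
    pairRefuted (T.profile a b c x) (T.profile a b c y) (T.arc x y) = refuted T.arc a b c x y := by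
  have : model5 (T.profile a b c x) (T.profile a b c y) (T.arc x y) = fun i j =>
      T.arc ([a, b, c, x, y].get i) ([a, b, c, x, y].get j) := by
    funext i j
    exact model5_eq hab hbc hca hn i j
  rw [pairRefuted, this]
  rfl

/-- A refuting pair consists of distinct vertices outside the 3-cycle. -/
theorem nodup_of_refutes (hab : T.arc a b = true) (hbc : T.arc b c = true)
    (hca : T.arc c a = true) {u v : V} (h : refutes T.arc a b c u v = true) :
    [a, b, c, u, v].Nodup := by
  obtain ⟨h1, h2, h3, h4⟩ := ne_of_refutes hab hbc hca h
  obtain ⟨h5, h6, h7, -⟩ := ne_of_refutes hab hbc hca ((refutes_comm ..).trans h)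
  have := T.ne_of_arc hab
  have := T.ne_of_arc hbc
  have := T.ne_of_arc hca
  simp only [List.nodup_cons, List.mem_cons, List.not_mem_nil, List.nodup_nil]
  grind

theorem nodup_of_refuted (hab : T.arc a b = true) (hbc : T.arc b c = true)
    (hca : T.arc c a = true) {u v : V} (h : refuted T.arc a b c u v ≠ ⊥) :
    [a, b, c, u, v].Nodup := by
  have : refutes T.arc b c a u v = true ∨ refutes T.arc c a b u v = true ∨
      refutes T.arc a b c u v = true := by
    by_contra hcon
    simp only [not_or, Bool.not_eq_true] at hcon
    exact h (by simp only [refuted, hcon]; rfl)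
  -- The candidate sets that leave out `a` and `b` are those of the rotated 3-cycles.
  rcases this with h | h | h
  · exact (nodup_of_refutes hbc hca hab h).perm (List.perm_append_comm_assoc [b, c] [a] [u, v])
  · exact (nodup_of_refutes hca hab hbc h).perm (List.perm_append_comm_assoc [c] [a, b] [u, v])
  · exact nodup_of_refutes hab hbc hca h

/-- In the absence of copies, a candidate set that fails is refuted by a pair. -/
theorem exists_refutes (hT : ¬ HasCopy T.arc) (hab : T.arc a b = true) (hbc : T.arc b c = true)
    (hca : T.arc c a = true) {p q r : V}
    (h : invCycle T.arc (candidate T.arc a b c) p q r = true) :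
    ∃ u v, refutes T.arc a b c u v = true := by
  -- A 3-cycle that meets `{a, b, c}` is a refutation by its other two vertices. All others lie in
  -- a subtournament on six vertices.
  by_contra! hno
  simp only [ne_eq, Bool.not_eq_true] at hno
  have hp : ∀ {p q r}, invCycle T.arc (candidate T.arc a b c) p q r = true →
      p ≠ a ∧ p ≠ b ∧ p ≠ c ∧ p ≠ q := by
    intro p q r h
    have h' := hno q r
    simp only [refutes, List.any_cons, List.any_nil, Bool.or_eq_false_iff] at h'
    refine ⟨?_, ?_, ?_, ?_⟩
    · rintro rfl; simp [h'] at h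
    · rintro rfl; simp [h'] at h
    · rintro rfl; simp [h'] at h
    · rintro rfl; simp [invCycle, T.invArc_self] at h
  have h2 := (invCycle_rotate ..).trans h
  have h3 := (invCycle_rotate ..).trans h2
  have hp1 := hp h
  have hp2 := hp h2
  have hp3 := hp h3
  have hn : [a, b, c, p, q, r].Nodup := by
    have := T.ne_of_arc hab
    have := T.ne_of_arc hbc
    have := T.ne_of_arc hca
    simp only [List.nodup_cons, List.mem_cons, List.not_mem_nil, List.nodup_nil]
    grind
  have hpq : [a, b, c, p, q].Nodup := hn.sublist (by simp)
  have hpr : [a, b, c, p, r].Nodup := hn.sublist (by simp)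
  have hqr : [a, b, c, q, r].Nodup := hn.sublist (by simp)
  have hM : model6 (T.profile a b c p) (T.profile a b c q) (T.profile a b c r)
      (T.arc p q) (T.arc p r) (T.arc q r) =
        fun i j => T.arc ([a, b, c, p, q, r].get i) ([a, b, c, p, q, r].get j) := by
    funext i j
    exact model6_eq hab hbc hca hn i j
  refine hT ((hasCopy_model6_of_invCycle (T.profile a b c p) (T.profile a b c q) (T.arc p q) ?_
    (T.profile a b c r) (T.arc p r) ?_ (T.arc q r) ?_ ?_).map _ (model6_eq hab hbc hca hn))
  · rw [pairRefuted_eq hab hbc hca hpq]; exact hno p q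
  · rw [pairRefuted_eq hab hbc hca hpr]; exact hno p r
  · rw [pairRefuted_eq hab hbc hca hqr]; exact hno q r
  · rw [hM]; exact h

/-- In the absence of copies, no pair refutes all three candidate sets. -/
theorem refuted_ne_top (hT : ¬ HasCopy T.arc) (hab : T.arc a b = true) (hbc : T.arc b c = true)
    (hca : T.arc c a = true) (x y : V) : refuted T.arc a b c x y ≠ ⊤ := by
  intro h
  have hn := nodup_of_refuted hab hbc hca (u := x) (v := y) (by rw [h]; decide)
  rw [← pairRefuted_eq hab hbc hca hn] at h
  exact hT ((hasCopy_model5 _ _ _ h).map _ (model5_eq hab hbc hca hn))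

/-- A pair that refutes a candidate set refutes at least two of them. -/
theorem majority_refuted (hab : T.arc a b = true) (hbc : T.arc b c = true)
    (hca : T.arc c a = true) {x y : V} (h : refuted T.arc a b c x y ≠ ⊥) :
    (refuted T.arc a b c x y).Majority := by
  have hn := nodup_of_refuted hab hbc hca h
  rw [← pairRefuted_eq hab hbc hca hn] at h ⊢
  exact majority_pairRefuted _ _ _ h

/-- In the absence of copies, two pairs with a common vertex do not refute all three candidate
sets together. -/
theorem refuted_sup_ne_top_of_common (hT : ¬ HasCopy T.arc) (hab : T.arc a b = true)
    (hbc : T.arc b c = true) (hca : T.arc c a = true) (x y z : V) :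
    refuted T.arc a b c x y ⊔ refuted T.arc a b c x z ≠ ⊤ := by
  intro h
  have hy := refuted_ne_top hT hab hbc hca x y
  have hz := refuted_ne_top hT hab hbc hca x z
  have hy' : refuted T.arc a b c x y ≠ ⊥ := fun h0 => hz (by rwa [h0, bot_sup_eq] at h)
  have hz' : refuted T.arc a b c x z ≠ ⊥ := fun h0 => hy (by rwa [h0, sup_bot_eq] at h)
  have hyz : y ≠ z := by
    rintro rfl
    exact hy (by rwa [sup_idem] at h)
  have hny := nodup_of_refuted hab hbc hca hy'
  have hnz := nodup_of_refuted hab hbc hca hz'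
  have hn : [a, b, c, x, y, z].Nodup := by
    simp only [List.nodup_cons, List.mem_cons, List.not_mem_nil, List.nodup_nil] at hny hnz ⊢
    grind
  rw [← pairRefuted_eq hab hbc hca hny] at h hy hy'
  rw [← pairRefuted_eq hab hbc hca hnz] at h hz
  exact hT ((hasCopy_model6_of_sup _ _ _ hy' hy _ _ hz h _).map _ (model6_eq hab hbc hca hn))

theorem Triple.sup_eq_top_or : ∀ k l m : Triple, k ⊔ l = ⊤ → k.Majority → l.Majority →
    m.Majority → k ⊔ m = ⊤ ∨ m ⊔ l = ⊤ := by
  decide +kernel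

/-- In the absence of copies, two pairs do not refute all three candidate sets together. -/
theorem refuted_sup_ne_top (hT : ¬ HasCopy T.arc) (hab : T.arc a b = true)
    (hbc : T.arc b c = true) (hca : T.arc c a = true) (x y z w : V) :
    refuted T.arc a b c x y ⊔ refuted T.arc a b c z w ≠ ⊤ := by
  intro h
  have common := refuted_sup_ne_top_of_common hT hab hbc hca
  have hy := refuted_ne_top hT hab hbc hca x y
  have hw := refuted_ne_top hT hab hbc hca z w
  have hy' : refuted T.arc a b c x y ≠ ⊥ := fun h0 => hw (by rwa [h0, bot_sup_eq] at h)
  have hw' : refuted T.arc a b c z w ≠ ⊥ := fun h0 => hy (by rwa [h0, sup_bot_eq] at h)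
  have hny := nodup_of_refuted hab hbc hca hy'
  have hnw := nodup_of_refuted hab hbc hca hw'
  have partner : ∀ {p q s : V}, s ∈ [p, q] →
      ∃ s', refuted T.arc a b c p q = refuted T.arc a b c s s' := by
    intro p q s hs
    rcases List.mem_pair.1 hs with rfl | rfl
    exacts [⟨q, rfl⟩, ⟨p, refuted_comm ..⟩]
  -- A refuting pair with one vertex in each given pair would, together with one of them, refute
  -- all three candidate sets.
  have cross : ∀ s ∈ [x, y], ∀ t ∈ [z, w], refuted T.arc a b c s t = ⊥ := by
    intro s hs t ht
    by_contra hst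
    obtain ⟨s', hs'⟩ := partner hs
    obtain ⟨t', ht'⟩ := partner ht
    rcases Triple.sup_eq_top_or _ _ _ h (majority_refuted hab hbc hca hy')
      (majority_refuted hab hbc hca hw') (majority_refuted hab hbc hca hst) with h1 | h1
    · exact common s s' t (hs' ▸ h1)
    · exact common t s t' (by rwa [refuted_comm T.arc a b c t s, ← ht'])
  have disjoint : ∀ s ∈ [x, y], ∀ t ∈ [z, w], s ≠ t := by
    rintro s hs t ht rfl
    obtain ⟨s', hs'⟩ := partner hs
    obtain ⟨t', ht'⟩ := partner ht
    exact common s s' t' (by rw [← hs', ← ht', h])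
  have hn : [a, b, c, x, y, z, w].Nodup := by
    simp only [List.nodup_cons, List.mem_cons, List.not_mem_nil, List.nodup_nil] at hny hnw ⊢
    simp only [List.mem_cons, List.not_mem_nil] at disjoint
    grind
  have hnxz : [a, b, c, x, z].Nodup := hn.sublist (by simp)
  have hnyz : [a, b, c, y, z].Nodup := hn.sublist (by simp)
  have hnxw : [a, b, c, x, w].Nodup := hn.sublist (by simp)
  have hnyw : [a, b, c, y, w].Nodup := hn.sublist (by simp)
  have hxz := cross x (by simp) z (by simp)
  have hyz := cross y (by simp) z (by simp)
  have hxw := cross x (by simp) w (by simp)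
  have hyw := cross y (by simp) w (by simp)
  rw [← pairRefuted_eq hab hbc hca hny] at h hy hy'
  rw [← pairRefuted_eq hab hbc hca hnw] at h hw
  rw [← pairRefuted_eq hab hbc hca (by assumption)] at hxz hyz hxw hyw
  exact hT (.inr (.inr (.inl ((realizes_colsV5_model7 _ _ _ hy' hy _ _ _ hw h _ hxz _ hyz _ hxw
    _ hyw).map _ (model7_eq hab hbc hca hn)))))

/-- The first triple contains the first index and another one, so that it and one of the triples
containing the second and the third index cover everything. -/
theorem Triple.exists_sup_eq_top : ∀ k l m : Triple,
    k.1 ∧ l.2.1 ∧ m.2.2 ∧ k.Majority → k ⊔ l = ⊤ ∨ k ⊔ m = ⊤ := by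
  decide +kernel

/-- In the absence of copies, one of the three candidate sets of any 3-cycle works. -/
theorem invertible_of_not_hasCopy (hT : ¬ HasCopy T.arc) : T.Invertible := by
  by_contra hinv
  have hcycle : ∀ X : Set V, ∃ p q r, (T.inv X).Adj p q ∧ (T.inv X).Adj q r ∧
      (T.inv X).Adj r p := by
    intro X
    have h : ¬ (T.inv X).IsAcyclic := fun h => hinv ⟨X, h⟩
    rw [isAcyclic_iff] at h
    push Not at h
    exact h
  obtain ⟨a, b, c, hab, hbc, hca⟩ := hcycle ∅
  rw [inv_empty] at hab hbc hca
  have hab : T.arc a b = true := decide_eq_true hab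
  have hbc : T.arc b c = true := decide_eq_true hbc
  have hca : T.arc c a = true := decide_eq_true hca
  have exists_pair : ∀ {a b c}, T.arc a b = true → T.arc b c = true → T.arc c a = true →
      ∃ u v, refutes T.arc a b c u v = true := by
    intro a b c hab hbc hca
    obtain ⟨p, q, r, h⟩ := hcycle {v | candidate T.arc a b c v}
    exact exists_refutes hT hab hbc hca ((T.invCycle_eq_true_iff _ p q r).2 h)
  -- Each of the three candidate sets is refuted by a pair.
  obtain ⟨u, u', hu⟩ := exists_pair hbc hca hab
  obtain ⟨v, v', hv⟩ := exists_pair hca hab hbc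
  obtain ⟨w, w', hw⟩ := exists_pair hab hbc hca
  have hmaj := majority_refuted hab hbc hca (x := u) (y := u') fun h =>
    Bool.false_ne_true ((congrArg Prod.fst h).symm.trans hu)
  rcases Triple.exists_sup_eq_top (refuted T.arc a b c u u') (refuted T.arc a b c v v')
    (refuted T.arc a b c w w') ⟨hu, hv, hw, hmaj⟩ with h | h
  · exact refuted_sup_ne_top hT hab hbc hca _ _ _ _ h
  · exact refuted_sup_ne_top hT hab hbc hca _ _ _ _ h

end candidates

/-! ### The five tournaments -/

instance inv.decidableAdj (T : Tournament V) [DecidableRel T.Adj] (X : Set V)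
    [DecidablePred (· ∈ X)] : DecidableRel (T.inv X).Adj := fun x y =>
  inferInstanceAs (Decidable (((x ∈ X ∧ y ∈ X) ∧ T.Adj y x) ∨ (¬ (x ∈ X ∧ y ∈ X) ∧ T.Adj x y)))

instance chain.decidableAdj (n : ℕ) : DecidableRel (chain n).Adj := fun x y =>
  inferInstanceAs (Decidable (x < y))

instance B6.decidableAdj : DecidableRel B6.Adj := fun x y =>
  inferInstanceAs (Decidable ((y : ZMod 7) - x ∈ ({1, 2, 4} : Finset (ZMod 7))))

instance C3dot2.decidableAdj : DecidableRel C3dot2.Adj :=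
  inferInstanceAs (DecidableRel (((chain 6).inv {0, 2}).inv {3, 5}).Adj)

instance D5.decidableAdj : DecidableRel D5.Adj :=
  inferInstanceAs (DecidableRel (((chain 5).inv {1, 3}).inv {0, 4}).Adj)

instance T5.decidableAdj : DecidableRel T5.Adj :=
  inferInstanceAs (DecidableRel (((chain 5).inv {0, 2, 4}).inv {1, 3}).Adj)

instance V5.decidableAdj : DecidableRel V5.Adj :=
  inferInstanceAs (DecidableRel (((chain 5).inv {0, 2, 4}).inv {0, 2}).Adj)

/-- `T` is not invertible, but all tournaments `T - x` are. -/
def IsObstruction (T : Tournament V) : Prop := ¬ T.Invertible ∧ ∀ x, (T.delete x).Invertible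

/-- A criterion for obstructions with a decidable hypothesis: it quantifies over finsets only. -/
theorem isObstruction_of_forall_finset [Fintype V] [DecidableEq V] {T : Tournament V}
    (h : ∀ X : Finset V, ∃ p q r, (T.inv X).Adj p q ∧ (T.inv X).Adj q r ∧ (T.inv X).Adj r p)
    (h' : ∀ x, ∃ X : Finset V, ∀ p, p ≠ x → ∀ q, q ≠ x → (T.inv X).Adj p q →
      ∀ r, r ≠ x → (T.inv X).Adj q r → ¬ (T.inv X).Adj r p) : T.IsObstruction := by
  constructor
  · rintro ⟨X, hX⟩
    classical
    obtain ⟨p, q, r, hpq, hqr, hrp⟩ := h X.toFinset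
    rw [Set.coe_toFinset] at hpq hqr hrp
    exact (isAcyclic_iff _).1 hX p q r hpq hqr hrp
  · intro x
    obtain ⟨X, hX⟩ := h' x
    refine ⟨Subtype.val ⁻¹' (X : Set V), (isAcyclic_iff _).2 fun p q r hpq hqr => ?_⟩
    exact hX p p.2 q q.2 hpq r r.2 hqr

set_option synthInstance.maxHeartbeats 400000 in
set_option synthInstance.maxSize 1000 in
theorem isObstruction_B6 : B6.IsObstruction :=
  isObstruction_of_forall_finset (by decide +kernel) (by decide +kernel)

set_option synthInstance.maxHeartbeats 400000 in
set_option synthInstance.maxSize 1000 in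
theorem isObstruction_C3dot2 : C3dot2.IsObstruction :=
  isObstruction_of_forall_finset (by decide +kernel) (by decide +kernel)

set_option synthInstance.maxHeartbeats 400000 in
set_option synthInstance.maxSize 1000 in
theorem isObstruction_D5 : D5.IsObstruction :=
  isObstruction_of_forall_finset (by decide +kernel) (by decide +kernel)

set_option synthInstance.maxHeartbeats 400000 in
set_option synthInstance.maxSize 1000 in
theorem isObstruction_T5 : T5.IsObstruction :=
  isObstruction_of_forall_finset (by decide +kernel) (by decide +kernel)

set_option synthInstance.maxHeartbeats 400000 in
set_option synthInstance.maxSize 1000 in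
theorem isObstruction_V5 : V5.IsObstruction :=
  isObstruction_of_forall_finset (by decide +kernel) (by decide +kernel)

/-- A criterion for criticality with a decidable hypothesis. In `T - x`, a nontrivial interval is
given by a finset `X` not containing `x`. -/
theorem isCritical_of_forall_finset [Fintype V] [DecidableEq V] [Nonempty V] {T : Tournament V}
    (h : ∀ X : Finset V, (∀ y, y ∉ X → ∀ x ∈ X, ∀ x' ∈ X, (T.Adj x y ↔ T.Adj x' y)) →
      X = ∅ ∨ X = Finset.univ ∨ ∃ x, X = {x})
    (h' : ∀ x, ∃ X : Finset V, x ∉ X ∧ (∃ y ∉ X, y ≠ x) ∧ (∃ y ∈ X, ∃ z ∈ X, y ≠ z) ∧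
      ∀ y, y ≠ x → y ∉ X → ∀ z ∈ X, ∀ z' ∈ X, (T.Adj z y ↔ T.Adj z' y) ∧
        (T.Adj y z ↔ T.Adj y z')) : T.IsCritical := by
  refine ⟨inferInstance, inferInstance, fun X hX => ?_, fun x hind => ?_⟩
  · classical
    have := h X.toFinset fun y hy x hx x' hx' =>
      (hX y (by simpa using hy) x (by simpa using hx) x' (by simpa using hx')).1
    simpa [← Finset.coe_inj] using this
  · obtain ⟨X, hx, ⟨y, hyX, hy⟩, ⟨s, hs, t, ht, hst⟩, hX⟩ := h' x
    rcases hind (Subtype.val ⁻¹' (X : Set V)) fun y hy z hz z' hz' =>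
      hX y y.2 hy z hz z' hz' with h0 | h1 | ⟨z, hz⟩
    · exact Set.eq_empty_iff_forall_notMem.1 h0 ⟨s, fun h => hx (h ▸ hs)⟩ hs
    · exact hyX (Set.eq_univ_iff_forall.1 h1 ⟨y, hy⟩)
    · have h2 : (⟨s, fun h => hx (h ▸ hs)⟩ : {y // y ≠ x}) = z := by
        have : (⟨s, fun h => hx (h ▸ hs)⟩ : {y // y ≠ x}) ∈ Subtype.val ⁻¹' (X : Set V) := hs
        rwa [hz] at this
      have h3 : (⟨t, fun h => hx (h ▸ ht)⟩ : {y // y ≠ x}) = z := by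
        have : (⟨t, fun h => hx (h ▸ ht)⟩ : {y // y ≠ x}) ∈ Subtype.val ⁻¹' (X : Set V) := ht
        rwa [hz] at this
      exact hst (congrArg Subtype.val (h2.trans h3.symm))

set_option synthInstance.maxHeartbeats 400000 in
set_option synthInstance.maxSize 1000 in
theorem isCritical_T5 : T5.IsCritical :=
  isCritical_of_forall_finset (by decide +kernel) (by decide +kernel)

set_option synthInstance.maxHeartbeats 400000 in
set_option synthInstance.maxSize 1000 in
theorem isCritical_V5 : V5.IsCritical :=
  isCritical_of_forall_finset (by decide +kernel) (by decide +kernel)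

theorem realizes_of_embeds {S : Tournament W} {T : Tournament V} [DecidableRel S.Adj]
    [DecidableRel T.Adj] {cols : List (List Bool)} (hS : Realizes S.arc cols [])
    (h : S.Embeds T) : Realizes T.arc cols [] := by
  obtain ⟨f⟩ := h
  exact hS.map f fun x y => by simp [arc, f.map_rel_iff]

theorem realizes_B6 : Realizes B6.arc colsB6 [] := by
  refine ⟨⟨0, by decide⟩, by decide, ⟨1, by decide⟩, by decide, ⟨2, by decide⟩, by decide,
    ⟨3, by decide⟩, by decide, ⟨4, by decide⟩, by decide, ⟨5, by decide⟩, by decide, trivial⟩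

theorem embeds_of_hasCopy (T : Tournament V) [DecidableRel T.Adj] (h : HasCopy T.arc) :
    ∃ S ∈ fiveTournaments, S.2.Embeds T := by
  simp only [HasCopy, colsB6, colsC3dot2, colsD5, colsT5, colsV5, Realizes, Matches, arc,
    List.nil_append, List.cons_append, cond_true, cond_false, Bool.and_true, Bool.and_eq_true,
    decide_eq_true_eq, and_true, true_and] at h
  rcases h with ⟨x0, x1, h1, x2, h2, x3, h3, x4, h4⟩ | ⟨x0, x1, h1, x2, h2, x3, h3, x4, h4⟩ |
    ⟨x0, x1, h1, x2, h2, x3, h3, x4, h4⟩ | ⟨x0, x1, h1, x2, h2, x3, h3, x4, h4, x5, h5⟩ |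
    ⟨x0, x1, h1, x2, h2, x3, h3, x4, h4, x5, h5⟩
  · refine ⟨⟨_, D5⟩, by simp [fiveTournaments], embeds_of_hom ![x0, x1, x2, x3, x4] ?_⟩
    intro i j hij
    fin_cases i <;> fin_cases j <;> first | exact absurd hij (by decide) | simp [*]
  · refine ⟨⟨_, T5⟩, by simp [fiveTournaments], embeds_of_hom ![x0, x1, x2, x3, x4] ?_⟩
    intro i j hij
    fin_cases i <;> fin_cases j <;> first | exact absurd hij (by decide) | simp [*]
  · refine ⟨⟨_, V5⟩, by simp [fiveTournaments], embeds_of_hom ![x0, x1, x2, x3, x4] ?_⟩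
    intro i j hij
    fin_cases i <;> fin_cases j <;> first | exact absurd hij (by decide) | simp [*]
  · -- `ZMod 7` is `Fin 7` by definition; the value of `f` at `6` is irrelevant, as `6 ∉ B₆`.
    let f : Fin 7 → V := ![x0, x1, x2, x3, x4, x5, x0]
    refine ⟨⟨_, B6⟩, by simp [fiveTournaments], embeds_of_hom (fun y => f y.1) ?_⟩
    have key : ∀ i j : Fin 7, i ≠ 6 → j ≠ 6 → P7.Adj i j → T.Adj (f i) (f j) := by
      intro i j hi hj hij
      have hij : j - i ∈ ({1, 2, 4} : Finset (Fin 7)) := hij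
      fin_cases i <;> fin_cases j <;> first
        | exact absurd hij (by decide)
        | exact absurd rfl hi
        | exact absurd rfl hj
        | simp [f, *]
    exact fun (i j : {y : ZMod 7 // y ≠ 6}) hij => key i.1 j.1 i.2 j.2 hij
  · refine ⟨⟨_, C3dot2⟩, by simp [fiveTournaments], embeds_of_hom ![x0, x1, x2, x3, x4, x5] ?_⟩
    intro i j hij
    fin_cases i <;> fin_cases j <;> first | exact absurd hij (by decide) | simp [*]

theorem pairwise_not_isomorphic :
    [(⟨_, B6⟩ : AnyTournament.{0}), ⟨_, C3dot2⟩, ⟨_, D5⟩, ⟨_, T5⟩, ⟨_, V5⟩].Pairwise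
      (fun S S' => ¬ S.2.Isomorphic S'.2) := by
  -- In each case, a search shows that the first tournament does not even embed in the second.
  have key : ∀ {V W : Type} (S : Tournament V) (T : Tournament W) [DecidableRel S.Adj]
      [DecidableRel T.Adj] (cols : List (List Bool)), Realizes S.arc cols [] →
      ¬ Realizes T.arc cols [] → ¬ S.Isomorphic T :=
    fun S T _ _ cols hS hT ⟨e⟩ => hT (realizes_of_embeds hS ⟨e.toRelEmbedding⟩)
  have hC : Realizes C3dot2.arc colsC3dot2 [] := by decide +kernel
  have hD : Realizes D5.arc colsD5 [] := by decide +kernel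
  have hT : Realizes T5.arc colsT5 [] := by decide +kernel
  simp only [List.pairwise_cons, List.mem_cons, List.not_mem_nil, or_false, forall_eq_or_imp,
    forall_eq, false_imp_iff, implies_true, and_true, List.Pairwise.nil]
  refine ⟨⟨?_, ?_, ?_, ?_⟩, ⟨?_, ?_, ?_⟩, ⟨?_, ?_⟩, ?_⟩
  · exact key _ _ colsB6 realizes_B6 (by decide +kernel)
  · exact key _ _ colsB6 realizes_B6 (by decide +kernel)
  · exact key _ _ colsB6 realizes_B6 (by decide +kernel)
  · exact key _ _ colsB6 realizes_B6 (by decide +kernel)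
  · exact key _ _ colsC3dot2 hC (by decide +kernel)
  · exact key _ _ colsC3dot2 hC (by decide +kernel)
  · exact key _ _ colsC3dot2 hC (by decide +kernel)
  · exact key _ _ colsD5 hD (by decide +kernel)
  · exact key _ _ colsD5 hD (by decide +kernel)
  · exact key _ _ colsT5 hT (by decide +kernel)

/-! ### The bounds -/

theorem isObstruction_of_mem {S : AnyTournament.{0}} (hS : S ∈ fiveTournaments) :
    S.2.IsObstruction := by
  rcases hS with rfl | rfl | rfl | rfl | rfl
  exacts [isObstruction_B6, isObstruction_C3dot2, isObstruction_D5, isObstruction_T5,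
    isObstruction_V5]

theorem mem_finiteInversionClass_one_iff (T : AnyTournament.{u}) :
    T ∈ finiteInversionClass.{u} 1 ↔ Finite T.1 ∧ T.2.Invertible :=
  and_congr_right fun _ => T.2.inversionIndex_le_one_iff

theorem mem_bounds_iff (T : AnyTournament.{u}) :
    T ∈ bounds (finiteInversionClass.{u} 1) ↔ Finite T.1 ∧ T.2.IsObstruction := by
  simp only [bounds, Set.mem_ofPred_eq, mem_finiteInversionClass_one_iff, IsObstruction]
  constructor
  · rintro ⟨hfin, hT, hdel⟩
    exact ⟨hfin, fun h => hT ⟨hfin, h⟩, fun x => (hdel x).2⟩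
  · rintro ⟨hfin, hT, hdel⟩
    exact ⟨hfin, fun h => hT h.2, fun x => ⟨inferInstance, hdel x⟩⟩

theorem invertible_iff (T : Tournament V) :
    T.Invertible ↔ ∀ S ∈ fiveTournaments, ¬ S.2.Embeds T := by
  constructor
  · exact fun hT S hS hST => (isObstruction_of_mem hS).1 (hT.of_embeds hST)
  · intro h
    classical
    refine invertible_of_not_hasCopy fun hcopy => ?_
    obtain ⟨S, hS, hST⟩ := embeds_of_hasCopy T hcopy
    exact h S hS hST

theorem IsObstruction.of_isomorphic {S : Tournament W} {T : Tournament V} (h : S.Isomorphic T)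
    (hS : S.IsObstruction) : T.IsObstruction := by
  obtain ⟨e⟩ := h
  refine ⟨fun hT => hS.1 (hT.of_embeds ⟨e.toRelEmbedding⟩), fun x => ?_⟩
  refine (hS.2 (e.symm x)).of_embeds (embeds_of_hom
    (fun y => ⟨e.symm y.1, fun h => y.2 (e.symm.injective h)⟩) fun y z hyz => ?_)
  exact e.symm.map_rel_iff.2 hyz

/-- A copy of a non-invertible tournament in an obstruction is not contained in any `T - x`, so
that it is the whole tournament. -/
theorem IsObstruction.isomorphic_of_embeds {S : Tournament W} {T : Tournament V}
    (hT : T.IsObstruction) (hS : ¬ S.Invertible) (h : S.Embeds T) : S.Isomorphic T := by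
  obtain ⟨f⟩ := h
  have hf : Function.Surjective f := by
    by_contra hsurj
    obtain ⟨x, hx⟩ := not_forall.1 hsurj
    refine hS ((hT.2 x).of_embeds (embeds_of_hom (fun y => ⟨f y, fun h => hx ⟨y, h⟩⟩) ?_))
    exact fun y z hyz => f.map_rel_iff.2 hyz
  exact ⟨RelIso.ofSurjective f hf⟩

end Tournament

open Tournament in
theorem mainTheorem3 :
    (∀ T : AnyTournament.{u},
      T ∈ bounds (finiteInversionClass.{u} 1) ↔
        ∃ S ∈ fiveTournaments, S.2.Isomorphic T.2) ∧
    [(⟨_, Tournament.B6⟩ : AnyTournament.{0}), ⟨_, Tournament.C3dot2⟩, ⟨_, Tournament.D5⟩,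
      ⟨_, Tournament.T5⟩, ⟨_, Tournament.V5⟩].Pairwise (fun S S' => ¬ S.2.Isomorphic S'.2) ∧
    Tournament.T5.IsCritical ∧ Tournament.V5.IsCritical ∧
    finiteInversionClass.{u} 1 = Forb.{u, 0} fiveTournaments := by
  refine ⟨fun T => ?_, pairwise_not_isomorphic, isCritical_T5, isCritical_V5, ?_⟩
  · rw [mem_bounds_iff]
    constructor
    · rintro ⟨-, hT⟩
      have := hT.1
      rw [invertible_iff] at this
      push Not at this
      obtain ⟨S, hS, hST⟩ := this
      exact ⟨S, hS, hT.isomorphic_of_embeds (isObstruction_of_mem hS).1 hST⟩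
    · rintro ⟨S, hS, hST⟩
      refine ⟨?_, (isObstruction_of_mem hS).of_isomorphic hST⟩
      have hfin : Finite S.1 := by
        rcases hS with rfl | rfl | rfl | rfl | rfl <;> dsimp only <;> infer_instance
      obtain ⟨e⟩ := hST
      exact Finite.of_equiv S.1 e.toEquiv
  · ext T
    rw [mem_finiteInversionClass_one_iff, invertible_iff]
    rfl
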